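/- Let $\mathbb K$ be $\mathbb R$ or $\mathbb C$, let $X,Y$ be completely regular (Hausdorff) realcompact spaces, and let $E,F$ be infinite-dimensional normed spaces over $\mathbb K$. For a topological space $Z$ and a normed space $G$, $C(Z,G)$ is the space of all continuous functions from $Z$ to $G$ with the topology of uniform convergence on compact subsets of $Z$. Here a completely regular space $Z$ is realcompact if every point of its Stone–Čech compactification $\beta Z$ at which the extensions $\beta Z\to\mathbb R\cup\{\infty\}$ of all continuous functions $f:Z\to\mathbb R$ take finite values lies in $Z$. A $\mathbb K$-linear map $T$ from $C(Z,G)$ to $C(Z',G')$ is separating if $\|f(\cdot)\|\,\|g(\cdot)\|\equiv 0$ implies $\|Tf(\cdot)\|\,\|Tg(\cdot)\|\equiv 0$, and biseparating if it is a separating bijection onto $C(Z',G')$ whose inverse is also separating. A point $z$ is a $P$-point if the intersection of every sequence of neighbourhoods of $z$ contains a neighbourhood of $z$. Then: (i) If the interior of the set of $P$-points of $Y$ is empty, then every biseparating map $T:C(X,E)\to C(Y,F)$ is continuous. (ii) If the interior of the set of $P$-points of $Y$ is nonempty, then there is a discontinuous biseparating map $T:C(Y,F)\to C(Y,F)$.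 (iii) If $\dim E=\dim F$ (algebraic, i.e. Hamel, dimensions), then all points of $Y$ are $P$-points if and only if for every linear bijection $J$ from $E$ onto $F$ (continuous or not) the map $T(f)=J\circ f$ is well defined (that is, $J\circ f$ is continuous for every $f\in C(Y,E)$) and biseparating from $C(Y,E)$ onto $C(Y,F)$. -/

import Mathlib

open Topology

universe u v

/-- A (completely regular) space `X` is realcompact when it coincides with its
realcompactification: every point `p` of the Stone–Čech compactification at which the extension
`βX → ℝ ∪ {∞}` of each continuous `f : X → ℝ` takes a finite value belongs to `X`. -/
def IsRealcompact (X : Type*) [TopologicalSpace X] : Prop :=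
  ∀ p : StoneCech X,
    (∀ f : C(X, ℝ),
      stoneCechExtend (OnePoint.continuous_coe.comp f.continuous :
        Continuous ((fun r : ℝ => (r : OnePoint ℝ)) ∘ f)) p ≠ OnePoint.infty) →
    p ∈ Set.range (stoneCechUnit : X → StoneCech X)

/-- `x` is a P-point: the intersection of any sequence of neighbourhoods of `x` contains a
neighbourhood of `x`. -/
def IsPPoint {X : Type*} [TopologicalSpace X] (x : X) : Prop :=
  ∀ U : ℕ → Set X, (∀ n, U n ∈ 𝓝 x) → (⋂ n, U n) ∈ 𝓝 x

section Separating

variable {𝕜 X Y E F : Type*} [RCLike 𝕜] [TopologicalSpace X] [TopologicalSpace Y]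
  [NormedAddCommGroup E] [NormedSpace 𝕜 E] [NormedAddCommGroup F] [NormedSpace 𝕜 F]

/-- A linear map `T` is separating if `‖f(·)‖ ‖g(·)‖ ≡ 0` implies `‖Tf(·)‖ ‖Tg(·)‖ ≡ 0`. -/
def IsSeparatingMap (T : C(X, E) →ₗ[𝕜] C(Y, F)) : Prop :=
  ∀ f g : C(X, E), (∀ x, ‖f x‖ * ‖g x‖ = 0) → ∀ y, ‖T f y‖ * ‖T g y‖ = 0

/-- A linear map `T` is biseparating if it is separating and has a (two-sided) inverse which is
separating as well. -/
def IsBiseparatingMap (T : C(X, E) →ₗ[𝕜] C(Y, F)) : Prop :=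
  IsSeparatingMap T ∧
    ∃ S : C(Y, F) →ₗ[𝕜] C(X, E),
      (∀ f, S (T f) = f) ∧ (∀ g, T (S g) = g) ∧ IsSeparatingMap S

end Separating

/-! A biseparating map is a weighted composition. Since `T` preserves disjointness, compactness of
βX gives for each y a point h y of βX whose germs determine `T f y`. Realcompactness puts h y in X,
the inverse of `T` supplies the inverse of h, and `T f y` turns out to depend on f (h y) only
(`IsBiseparatingMap.exists_homeomorph`). So `T` is a field of linear maps `fiberMap T y`, and is
continuous once these are bounded uniformly on compact sets.

P-points decide boundedness. At a P-point continuous functions are locally constant, so every linear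
bijection, however wild, preserves continuity there; an unbounded one acting on a clopen set of
P-points is the discontinuous example. At any other point, small vectors with large images can be
assembled into continuous functions, one of whose images would be unbounded nearby
(`fiberMap_bound`). On a compact set the same device concentrates any blow-up at one point, which
must be interior to the set of P-points (`exists_fiberMap_bound_of_isCompact`). For (iii) the field
is a constant `J`.

The device is a staircase: `stair v` composed with a scale such as -log f is locally constant inside
its steps, where dependence on germs computes `T`. Two copies shifted by 1/2 bring every point
inside a step. -/

open Filter Set

/-! ### Staircase curves -/

/-- The piecewise affine curve which equals `v n` on `[n, n + 2/3]`. -/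
noncomputable def stair {E : Type*} [AddCommGroup E] [Module ℝ E] (v : ℤ → E) (t : ℝ) : E :=
  v ⌊t⌋ + (max 0 (3 * Int.fract t - 2)) • (v (⌊t⌋ + 1) - v ⌊t⌋)

section Stair

variable {E : Type*} [NormedAddCommGroup E] [NormedSpace ℝ E]

theorem stair_eq_of_mem_Icc (v : ℤ → E) {n : ℤ} {t : ℝ} (ht : t ∈ Icc (n : ℝ) (n + 1)) :
    stair v t = v n + (max 0 (3 * (t - n) - 2)) • (v (n + 1) - v n) := by
  rcases eq_or_lt_of_le ht.2 with h | h
  · subst h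
    have h1 : ⌊(n : ℝ) + 1⌋ = n + 1 := by simp
    have h2 : Int.fract ((n : ℝ) + 1) = 0 := by simp
    rw [stair, h1, h2]
    norm_num
  · have h1 : ⌊t⌋ = n := Int.floor_eq_iff.2 ⟨ht.1, h⟩
    rw [stair, Int.fract, h1]

theorem continuous_stair (v : ℤ → E) : Continuous (stair v) := by
  have hlf : LocallyFinite fun n : ℤ => Icc (n : ℝ) (n + 1) := by
    intro t
    refine ⟨Ioo (t - 1) (t + 1), Ioo_mem_nhds (by linarith) (by linarith), ?_⟩
    refine (finite_Icc (⌊t⌋ - 2) (⌊t⌋ + 2)).subset ?_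
    rintro n ⟨s, ⟨h1, h2⟩, h3, h4⟩
    have h5 := Int.floor_le t
    have h6 := Int.lt_floor_add_one t
    constructor
    · have : (⌊t⌋ : ℝ) < n + 2 := by linarith
      have : ⌊t⌋ < n + 2 := by exact_mod_cast this
      omega
    · have : (n : ℝ) < ⌊t⌋ + 2 := by linarith
      have : n < ⌊t⌋ + 2 := by exact_mod_cast this
      omega
  refine hlf.continuous ?_ (fun n => isClosed_Icc) fun n => ?_
  · exact iUnion_Icc_intCast ℝ
  · refine ContinuousOn.congr ?_ fun t ht => stair_eq_of_mem_Icc v ht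
    fun_prop

theorem stair_eq (v : ℤ → E) {n : ℤ} {t : ℝ} (ht : t ∈ Ioo (n : ℝ) (n + 2 / 3)) :
    stair v t = v n := by
  rw [stair_eq_of_mem_Icc v ⟨ht.1.le, by linarith [ht.2]⟩,
    max_eq_left (by linarith [ht.2]), zero_smul, add_zero]

/-- Each value is a convex combination of two neighbouring `v n`, so decay or growth of `v` passes
to the curve. -/
theorem exists_norm_stair_le (v : ℤ → E) (t : ℝ) :
    ∃ m : ℤ, |(m : ℝ) - t| ≤ 1 ∧ ‖stair v t‖ ≤ ‖v m‖ := by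
  have h1 := Int.fract_nonneg t
  have h2 := Int.fract_lt_one t
  have h3 := Int.floor_add_fract t
  set c : ℝ := max 0 (3 * Int.fract t - 2)
  have hc0 : 0 ≤ c := le_max_left _ _
  have hc1 : c ≤ 1 := max_le zero_le_one (by linarith)
  have h : stair v t = (1 - c) • v ⌊t⌋ + c • v (⌊t⌋ + 1) := by
    rw [stair, smul_sub, sub_smul, one_smul]; abel
  have hle : ‖stair v t‖ ≤ (1 - c) * ‖v ⌊t⌋‖ + c * ‖v (⌊t⌋ + 1)‖ := by
    rw [h]
    refine (norm_add_le _ _).trans ?_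
    rw [norm_smul, norm_smul, Real.norm_of_nonneg hc0, Real.norm_of_nonneg (by linarith)]
  rcases le_total ‖v ⌊t⌋‖ ‖v (⌊t⌋ + 1)‖ with h4 | h4
  · refine ⟨⌊t⌋ + 1, ?_, ?_⟩
    · rw [abs_le]; push_cast; constructor <;> linarith
    · nlinarith
  · refine ⟨⌊t⌋, ?_, ?_⟩
    · rw [abs_le]; constructor <;> linarith
    · nlinarith

end Stair

/-- Every real number, shifted by `0` or by `1/2`, lies in the interior of a step. -/
theorem exists_mem_step (t : ℝ) :
    ∃ b : Bool, ∃ n : ℤ, t + (if b then 1 / 2 else 0) ∈ Ioo (n : ℝ) (n + 2 / 3) := by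
  have h1 := Int.floor_le t
  have h2 := Int.lt_floor_add_one t
  by_cases h : t < ⌊t⌋ + 1 / 6
  · exact ⟨true, ⌊t⌋, by simp only [if_true, mem_Ioo]; constructor <;> linarith⟩
  by_cases h' : t < ⌊t⌋ + 2 / 3
  · exact ⟨false, ⌊t⌋, by simp; constructor <;> linarith⟩
  · refine ⟨true, ⌊t⌋ + 1, ?_⟩
    simp only [if_true, mem_Ioo]; push_cast; constructor <;> linarith

/-! ### Bump and depth functions -/

section Bump

variable {X : Type*} [TopologicalSpace X] [CompletelyRegularSpace X]

theorem exists_continuousMap_zero_one {x : X} {U : Set X} (hU : U ∈ 𝓝 x) :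
    ∃ φ : C(X, ℝ), φ x = 0 ∧ (∀ z, 0 ≤ φ z ∧ φ z ≤ 1) ∧ ∀ z, z ∉ U → φ z = 1 := by
  obtain ⟨f, hf, hx, h1⟩ := CompletelyRegularSpace.completely_regular x (interior U)ᶜ
    isOpen_interior.isClosed_compl (by simpa [mem_interior_iff_mem_nhds] using hU)
  refine ⟨⟨fun z => (f z : ℝ), by fun_prop⟩, by simp [hx], fun z => ⟨(f z).2.1, (f z).2.2⟩,
    fun z hz => ?_⟩
  have : f z = 1 := h1 fun h => hz (interior_subset h)
  simp [this]

/-- Truncating a separating function makes it constant near the relevant points, as arguments about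
germs require. -/
theorem exists_bump {x : X} {U : Set X} (hU : U ∈ 𝓝 x) :
    ∃ φ : C(X, ℝ), (∀ᶠ z in 𝓝 x, φ z = 1) ∧ ∀ z, z ∉ U → ∀ᶠ w in 𝓝 z, φ w = 0 := by
  obtain ⟨f, hx, -, h1⟩ := exists_continuousMap_zero_one hU
  refine ⟨⟨fun z => max 0 (min 1 (2 - 3 * f z)), by fun_prop⟩, ?_, fun z hz => ?_⟩
  · filter_upwards [(f.continuous.tendsto x).eventually_lt_const
      (show f x < 1 / 3 by rw [hx]; norm_num)] with z hz
    simp [min_eq_left (show (1 : ℝ) ≤ 2 - 3 * f z by linarith)]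
  · filter_upwards [(f.continuous.tendsto z).eventually_const_lt
      (show 2 / 3 < f z by rw [h1 z hz]; norm_num)] with w hw
    simp only [ContinuousMap.coe_mk]
    exact max_eq_left ((min_le_right _ _).trans (by linarith))

/-- A function measuring how deep a point lies in a sequence of neighbourhoods. -/
theorem exists_depth {x : X} {U : ℕ → Set X} (hU : ∀ n, U n ∈ 𝓝 x) :
    ∃ f : C(X, ℝ), f x = 0 ∧ (∀ z, 0 ≤ f z) ∧ ∀ n z, f z < (2 : ℝ)⁻¹ ^ n → z ∈ U n := by
  choose φ h0 h01 h1 using fun n => exists_continuousMap_zero_one (hU n)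
  have hsum : Summable fun n : ℕ => (2 : ℝ)⁻¹ ^ n :=
    summable_geometric_of_lt_one (by norm_num) (by norm_num)
  have hle : ∀ n z, ‖(2 : ℝ)⁻¹ ^ n * φ n z‖ ≤ (2 : ℝ)⁻¹ ^ n := fun n z => by
    rw [Real.norm_of_nonneg (mul_nonneg (by positivity) (h01 n z).1)]
    exact mul_le_of_le_one_right (by positivity) (h01 n z).2
  refine ⟨⟨fun z => ∑' n, (2 : ℝ)⁻¹ ^ n * φ n z,
    continuous_tsum (fun n => by fun_prop) hsum hle⟩, by simp [h0], fun z => ?_, fun n z hz => ?_⟩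
  · exact tsum_nonneg fun n => mul_nonneg (by positivity) (h01 n z).1
  · by_contra hn
    have h2 : (2 : ℝ)⁻¹ ^ n * φ n z ≤ ∑' n, (2 : ℝ)⁻¹ ^ n * φ n z :=
      (Summable.of_norm_bounded hsum fun n => hle n z).le_tsum n
        fun m _ => mul_nonneg (by positivity) (h01 m z).1
    rw [h1 n z hn, mul_one] at h2
    exact absurd hz (not_lt.2 h2)

end Bump

/-- Composing `stair v` with `-log₂ f` gives a continuous function vanishing with `f` when
`v n → 0`. -/
theorem exists_stair_comp {X E : Type*} [TopologicalSpace X] [NormedAddCommGroup E]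
    [NormedSpace ℝ E] (f : C(X, ℝ)) (hf : ∀ x, 0 ≤ f x) (v : ℤ → E) (hv : Tendsto v atTop (𝓝 0))
    (c : ℝ) :
    ∃ G : C(X, E), ∀ x (n : ℤ), 0 < f x →
      -Real.logb 2 (f x) + c ∈ Ioo (n : ℝ) (n + 2 / 3) → G x = v n := by
  classical
  let G : X → E := fun x => if f x = 0 then 0 else stair v (-Real.logb 2 (f x) + c)
  have hG : Continuous G := by
    rw [continuous_iff_continuousAt]
    intro x
    by_cases hx : f x = 0
    · have hGx : G x = 0 := if_pos hx
      rw [ContinuousAt, hGx, Metric.tendsto_nhds]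
      intro ε hε
      obtain ⟨N, hN⟩ := ((Metric.tendsto_nhds.1 hv) ε hε).exists_forall_of_atTop
      -- The extra 1 pays for the index `m`, which may differ by 1 from the parameter of the curve.
      have hpos : (0 : ℝ) < (2 : ℝ) ^ (c - N - 1) := by positivity
      filter_upwards [(f.continuous.tendsto x).eventually_lt_const
        (show f x < (2 : ℝ) ^ (c - N - 1) by rwa [hx])] with z hz
      by_cases hz0 : f z = 0
      · simpa [G, hz0] using hε
      · have hfz : 0 < f z := lt_of_le_of_ne (hf z) (Ne.symm hz0)
        obtain ⟨m, hm, hle⟩ := exists_norm_stair_le v (-Real.logb 2 (f z) + c)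
        have h1 : Real.logb 2 (f z) < c - N - 1 := by
          rwa [Real.logb_lt_iff_lt_rpow (by norm_num) hfz]
        have h2 : (N : ℝ) ≤ m := by linarith [(abs_le.1 hm).1]
        have h3 := hN m (by exact_mod_cast h2)
        simp only [G, if_neg hz0, dist_zero_right] at h3 ⊢
        exact hle.trans_lt h3
    · have h1 : ContinuousAt (fun z => stair v (-Real.logb 2 (f z) + c)) x := by
        have h2 : ContinuousAt (fun z => Real.logb 2 (f z)) x :=
          f.continuous.continuousAt.logb hx
        refine (continuous_stair v).continuousAt.comp ?_
        exact h2.neg.add continuousAt_const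
      refine h1.congr ?_
      filter_upwards [(f.continuous.continuousAt (x := x)).eventually_ne hx] with z hz
      simp [G, hz]
  refine ⟨⟨G, hG⟩, fun x n hx hn => ?_⟩
  simp only [ContinuousMap.coe_mk, G, if_neg hx.ne']
  exact stair_eq v hn

/-! ### Support points of separating maps -/

section Support

variable {𝕜 X Y E F : Type*} [RCLike 𝕜] [TopologicalSpace X] [TopologicalSpace Y]
  [NormedAddCommGroup E] [NormedSpace 𝕜 E] [NormedAddCommGroup F] [NormedSpace 𝕜 F]

/-- Multiplication of a vector-valued continuous function by a real-valued one. -/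
noncomputable def realMul (𝕜 : Type*) {X E : Type*} [RCLike 𝕜] [TopologicalSpace X]
    [NormedAddCommGroup E] [NormedSpace 𝕜 E] (φ : C(X, ℝ)) (f : C(X, E)) : C(X, E) :=
  ⟨fun x => (φ x : 𝕜) • f x, by fun_prop⟩

@[simp]
theorem realMul_apply (φ : C(X, ℝ)) (f : C(X, E)) (x : X) :
    realMul 𝕜 φ f x = (φ x : 𝕜) • f x := rfl

/-- The value of `T f` at `y` depends on the germ of `f` along `l` only. -/
def DependsOnGerm (T : C(X, E) →ₗ[𝕜] C(Y, F)) (l : Filter X) (y : Y) : Prop :=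
  ∀ f : C(X, E), (∀ᶠ x in l, f x = 0) → T f y = 0

theorem DependsOnGerm.congr {T : C(X, E) →ₗ[𝕜] C(Y, F)} {l : Filter X} {y : Y}
    (h : DependsOnGerm T l y) {f g : C(X, E)} (hfg : ∀ᶠ x in l, f x = g x) : T f y = T g y := by
  have := h (f - g) (hfg.mono fun x hx => by simp [hx])
  rwa [map_sub, ContinuousMap.sub_apply, sub_eq_zero] at this

theorem IsSeparatingMap.eq_zero_or {T : C(X, E) →ₗ[𝕜] C(Y, F)} (hT : IsSeparatingMap T)
    {f g : C(X, E)} (h : ∀ x, f x = 0 ∨ g x = 0) (y : Y) : T f y = 0 ∨ T g y = 0 := by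
  have := hT f g (fun x => by rcases h x with h | h <;> simp [h]) y
  simpa using this

/-- A separating map which does not vanish at `y` has a support point in the Stone–Čech
compactification. -/
theorem exists_dependsOnGerm {T : C(X, E) →ₗ[𝕜] C(Y, F)} (hT : IsSeparatingMap T) {y : Y}
    {f₀ : C(X, E)} (hf₀ : T f₀ y ≠ 0) :
    ∃ p : StoneCech X, DependsOnGerm T (comap stoneCechUnit (𝓝 p)) y := by
  -- Otherwise finitely many cut-offs `1 - φ` multiply to 0 on all of βX, yet none of them changes
  -- `T g y`.
  have key : ∃ p : StoneCech X, ∀ U ∈ 𝓝 p, ∃ f : C(X, E),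
      (∀ x, stoneCechUnit x ∉ U → f x = 0) ∧ T f y ≠ 0 := by
    by_contra! hcon
    choose U hU hf using hcon
    have hind : ∃ ψ : C(StoneCech X, ℝ), (∀ q ∈ (univ : Set (StoneCech X)), ψ q = 0) ∧
        ∀ g : C(X, E), T (realMul 𝕜 (ψ.comp ⟨_, continuous_stoneCechUnit⟩) g) y = T g y := by
      refine isCompact_univ.induction_on
        (p := fun s => ∃ ψ : C(StoneCech X, ℝ), (∀ q ∈ s, ψ q = 0) ∧
        ∀ g : C(X, E), T (realMul 𝕜 (ψ.comp ⟨_, continuous_stoneCechUnit⟩) g) y = T g y)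
        ⟨1, by simp, fun g => ?_⟩ ?_ ?_ ?_
      · congr 2; ext x; simp
      · rintro s t hst ⟨ψ, h1, h2⟩
        exact ⟨ψ, fun q hq => h1 q (hst hq), h2⟩
      · rintro s t ⟨ψ, h1, h2⟩ ⟨ψ', h1', h2'⟩
        refine ⟨ψ * ψ', ?_, fun g => ?_⟩
        · rintro q (hq | hq)
          · simp [h1 q hq]
          · simp [h1' q hq]
        · rw [← h2' g, ← h2 (realMul 𝕜 (ψ'.comp _) g)]
          congr 2; ext x; simp [mul_smul]
      · intro p _
        obtain ⟨φ, h1, h0⟩ := exists_bump (hU p)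
        refine ⟨_, mem_nhdsWithin_of_mem_nhds h1, 1 - φ, fun q hq => ?_, fun g => ?_⟩
        · have : φ q = 1 := hq
          simp [this]
        · have h3 := hf p (realMul 𝕜 (φ.comp ⟨_, continuous_stoneCechUnit⟩) g) fun x hx => by
            simp [(h0 _ hx).self_of_nhds]
          have h4 : realMul 𝕜 ((1 - φ).comp ⟨_, continuous_stoneCechUnit⟩) g =
              g - realMul 𝕜 (φ.comp ⟨_, continuous_stoneCechUnit⟩) g := by
            ext x; simp [sub_smul]
          rw [h4, map_sub, ContinuousMap.sub_apply, h3, sub_zero]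
    obtain ⟨ψ, h0, h⟩ := hind
    refine hf₀ ?_
    have hz : realMul 𝕜 (ψ.comp ⟨_, continuous_stoneCechUnit⟩) f₀ = 0 := by
      ext x; simp [h0 (stoneCechUnit x) (mem_univ _)]
    rw [← h f₀, hz, map_zero, ContinuousMap.zero_apply]
  obtain ⟨p, hp⟩ := key
  refine ⟨p, fun f hf => ?_⟩
  obtain ⟨U, hU, hUf⟩ := mem_comap.1 hf
  obtain ⟨g, hg, hgy⟩ := hp U hU
  refine (hT.eq_zero_or (f := f) (g := g) (fun x => ?_) y).resolve_right hgy
  by_cases hx : stoneCechUnit x ∈ U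
  · exact Or.inl (hUf hx)
  · exact Or.inr (hg x hx)

/-- A function which is cut off outside `U` is still mapped to the same value. -/
theorem DependsOnGerm.realMul_eq {Z : Type*} [TopologicalSpace Z] {i : C(X, Z)}
    {T : C(X, E) →ₗ[𝕜] C(Y, F)} {p : Z} {y : Y} (h : DependsOnGerm T (comap i (𝓝 p)) y)
    {φ : C(Z, ℝ)} (hφ : ∀ᶠ z in 𝓝 p, φ z = 1) (f : C(X, E)) :
    T (realMul 𝕜 (φ.comp i) f) y = T f y :=
  h.congr <| by
    filter_upwards [tendsto_comap.eventually hφ] with x hx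
    simp [hx]

/-- A support map is continuous. -/
theorem continuous_of_dependsOnGerm {Z : Type*} [TopologicalSpace Z] [CompletelyRegularSpace Z]
    {i : C(X, Z)} {T : C(X, E) →ₗ[𝕜] C(Y, F)} {h : Y → Z}
    (hT : ∀ y, DependsOnGerm T (comap i (𝓝 (h y))) y) (hne : ∀ y, ∃ f, T f y ≠ 0) :
    Continuous h := by
  rw [continuous_iff_continuousAt]
  intro y U hU
  obtain ⟨φ, h1, h0⟩ := exists_bump hU
  obtain ⟨f, hf⟩ := hne y
  rw [← (hT y).realMul_eq h1] at hf
  change h ⁻¹' U ∈ 𝓝 y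
  filter_upwards [((T (realMul 𝕜 (φ.comp i) f)).continuous.continuousAt (x := y)).eventually_ne hf]
    with y' hy'
  by_contra hU'
  refine hy' (hT y' _ ?_)
  filter_upwards [tendsto_comap.eventually (h0 _ hU')] with x hx
  simp [hx]

/-- If the supports of `f` are nested then so are those of the images. -/
theorem exists_mem_of_biseparating [CompletelyRegularSpace Y] {T : C(X, E) →ₗ[𝕜] C(Y, F)}
    {S : C(Y, F) →ₗ[𝕜] C(X, E)} (hTS : ∀ g, T (S g) = g) (hT : IsSeparatingMap T)
    (hS : IsSeparatingMap S) [Nontrivial F] {O : Set Y} {f f' : C(X, E)}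
    (hf : ∀ y, T f y ≠ 0 → y ∈ O) (hff' : ∀ x, f x = 0 → f' x = 0) (hST : ∀ f, S (T f) = f)
    {y : Y} (hy : T f' y ≠ 0) : ∃ y' ∈ O, T f' y' ≠ 0 := by
  by_contra! hcon
  have hO : ∀ᶠ z in 𝓝 y, z ∉ O :=
    (((T f').continuous.continuousAt (x := y)).eventually_ne hy).mono fun z hz hzO => hz (hcon z hzO)
  obtain ⟨φ, h1, h0⟩ := exists_bump hO
  obtain ⟨u, hu⟩ := exists_ne (0 : F)
  -- `k` is disjoint from `T f`, so `S k` is disjoint from `f`, hence from `f'`; applying `T`, `k`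
  -- is disjoint from `T f'`, although both are nonzero at `y`.
  set k : C(Y, F) := realMul 𝕜 φ (ContinuousMap.const Y u)
  have hky : k y ≠ 0 := by simp [k, h1.self_of_nhds, hu]
  have hk : ∀ z, k z = 0 ∨ T f z = 0 := fun z => by
    by_cases hz : z ∈ O
    · left
      simp [k, (h0 z (by simpa using hz)).self_of_nhds]
    · right
      by_contra h
      exact hz (hf z h)
  have h2 : ∀ x, S k x = 0 ∨ f' x = 0 := fun x => by
    have := hS.eq_zero_or hk x
    rw [hST] at this
    exact this.imp_right (hff' x)
  have := hT.eq_zero_or h2 y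
  rw [hTS] at this
  tauto

end Support

/-! ### Representation as a weighted composition -/

section Representation

variable {𝕜 X Y E F : Type*} [RCLike 𝕜] [TopologicalSpace X] [TopologicalSpace Y]
  [NormedAddCommGroup E] [NormedSpace 𝕜 E] [NormedAddCommGroup F] [NormedSpace 𝕜 F]

theorem map_realMul_const (T : C(X, E) →ₗ[𝕜] C(Y, F)) {l : Filter X} {y : Y}
    (h : DependsOnGerm T l y) {φ : C(X, ℝ)} {f : C(X, E)} {a : ℝ} (hφ : ∀ᶠ x in l, φ x = a) :
    T (realMul 𝕜 φ f) y = (a : 𝕜) • T f y := by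
  have := h.congr (f := realMul 𝕜 φ f) (g := (a : 𝕜) • f) (hφ.mono fun x hx => by simp [hx])
  rw [this, map_smul, ContinuousMap.smul_apply]

theorem eventually_norm_lt (g : Bool → C(Y, F)) (y : Y) :
    ∃ M : ℝ, 0 ≤ M ∧ ∀ᶠ z in 𝓝 y, ∀ b, ‖g b z‖ < M := by
  refine ⟨‖g true y‖ + ‖g false y‖ + 1, by positivity, ?_⟩
  have h : ∀ b, ∀ᶠ z in 𝓝 y, ‖g b z‖ < ‖g true y‖ + ‖g false y‖ + 1 := fun b => by
    refine ((g b).continuous.norm.tendsto y).eventually_lt_const ?_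
    have h1 := norm_nonneg (g true y)
    have h2 := norm_nonneg (g false y)
    cases b <;> linarith
  filter_upwards [h true, h false] with z h1 h2 b
  cases b <;> assumption

/-- Near every point of `Y` there are points whose support lies where `f` is finite. -/
theorem exists_extend_ne_infty [CompletelyRegularSpace Y] [Nontrivial F]
    {T : C(X, E) →ₗ[𝕜] C(Y, F)} {S : C(Y, F) →ₗ[𝕜] C(X, E)} (hST : ∀ f, S (T f) = f)
    (hTS : ∀ g, T (S g) = g) (hT : IsSeparatingMap T) (hS : IsSeparatingMap S)
    {h : Y → StoneCech X} (hh : ∀ y, DependsOnGerm T (comap stoneCechUnit (𝓝 (h y))) y)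
    {y : Y} {O : Set Y} (hO : O ∈ 𝓝 y) {e : StoneCech X → OnePoint ℝ} (he : Continuous e)
    (hfin : ∀ x : X, e (stoneCechUnit x) ≠ OnePoint.infty) :
    ∃ y' ∈ O, e (h y') ≠ OnePoint.infty := by
  obtain ⟨u, hu⟩ := exists_ne (0 : F)
  obtain ⟨φ, h1, h0⟩ := exists_bump hO
  set g : C(X, E) := S (realMul 𝕜 φ (ContinuousMap.const Y u))
  have hTg : T g = realMul 𝕜 φ (ContinuousMap.const Y u) := hTS _
  have hg : ∃ x, g x ≠ 0 := by
    by_contra! hcon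
    have hg0 : g = 0 := by ext x; simp [hcon x]
    rw [hg0, map_zero] at hTg
    have := DFunLike.congr_fun hTg y
    simp [h1.self_of_nhds, hu.symm] at this
  obtain ⟨x, hx⟩ := hg
  have hN : {q | e q ≠ OnePoint.infty} ∈ 𝓝 (stoneCechUnit x) :=
    (he.tendsto _).eventually_ne (hfin x)
  obtain ⟨ψ, hψ1, hψ0⟩ := exists_bump hN
  set g' : C(X, E) := realMul 𝕜 (ψ.comp ⟨_, continuous_stoneCechUnit⟩) g
  have hg' : g' x ≠ 0 := by simp [g', hψ1.self_of_nhds, hx]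
  have hTg' : ∃ z, T g' z ≠ 0 := by
    by_contra! hcon
    have h2 : T g' = 0 := by ext z; simp [hcon z]
    apply hg'
    rw [← hST g', h2, map_zero, ContinuousMap.zero_apply]
  obtain ⟨z, hz⟩ := hTg'
  obtain ⟨y', hy', hne⟩ := exists_mem_of_biseparating hTS hT hS (O := O) (f := g) (f' := g')
    (fun w hw => by
      by_contra hwO
      exact hw (by rw [hTg]; simp [(h0 w hwO).self_of_nhds]))
    (fun w hw => by simp [g', hw]) hST hz
  refine ⟨y', hy', fun hinf => hne (hh y' _ ?_)⟩
  filter_upwards [tendsto_comap.eventually (hψ0 (h y') (by simpa using hinf))] with w hw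
  simp [g', hw]

/-- The support points of a biseparating map belong to the realcompactification. -/
theorem mem_range_stoneCechUnit [CompletelyRegularSpace Y] [Nontrivial F] (hX : IsRealcompact X)
    {T : C(X, E) →ₗ[𝕜] C(Y, F)} {S : C(Y, F) →ₗ[𝕜] C(X, E)} (hST : ∀ f, S (T f) = f)
    (hTS : ∀ g, T (S g) = g) (hT : IsSeparatingMap T) (hS : IsSeparatingMap S)
    {h : Y → StoneCech X} (hc : Continuous h)
    (hh : ∀ y, DependsOnGerm T (comap stoneCechUnit (𝓝 (h y))) y) (y : Y) :
    h y ∈ range (stoneCechUnit : X → StoneCech X) := by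
  refine hX _ fun f hinf => ?_
  set e : StoneCech X → OnePoint ℝ := stoneCechExtend (OnePoint.continuous_coe.comp f.continuous :
        Continuous ((fun r : ℝ => (r : OnePoint ℝ)) ∘ f))
  have he : Continuous e := continuous_stoneCechExtend _
  have hef : ∀ x, e (stoneCechUnit x) = (f x : OnePoint ℝ) := stoneCechExtend_stoneCechUnit _
  obtain ⟨u, hu⟩ := exists_ne (0 : F)
  have hu0 : 0 < ‖u‖ := norm_pos_iff.2 hu
  set g : C(X, E) := S (ContinuousMap.const Y u)
  have hTg : T g = ContinuousMap.const Y u := hTS _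
  -- Near a support point where |f| is finite but large, one `φ b` is a large constant `n`, so `T`
  -- multiplies by `n`. As `T g` is the constant `u`, this contradicts local boundedness at `y`.
  let φ : Bool → C(X, ℝ) := fun b =>
    ⟨fun x => stair (fun n : ℤ => (n : ℝ)) (|f x| + if b then 1 / 2 else 0),
      (continuous_stair _).comp (by fun_prop)⟩
  obtain ⟨M, hM0, hM⟩ := eventually_norm_lt (fun b => T (realMul 𝕜 (φ b) g)) y
  have hfar : ∀ᶠ z in 𝓝 y, e (h z) ∉
      ((↑) : ℝ → OnePoint ℝ) '' Metric.closedBall 0 (M / ‖u‖ + 1) := by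
    refine (he.comp hc).continuousAt.eventually_mem (IsClosed.compl_mem_nhds ?_ ?_)
    · exact ((isCompact_closedBall _ _).image OnePoint.continuous_coe).isClosed
    · simp [hinf]
  obtain ⟨y', ⟨hy1, hy2⟩, hy3⟩ := exists_extend_ne_infty hST hTS hT hS hh (hM.and hfar) he
    (fun x => by simp [hef])
  obtain ⟨t, ht⟩ := OnePoint.ne_infty_iff_exists.1 hy3
  have htM : M / ‖u‖ + 1 < |t| := by
    by_contra! hle
    exact hy2 ⟨t, by simpa using hle, ht⟩
  obtain ⟨b, n, hn⟩ := exists_mem_step |t|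
  have hloc : ∀ᶠ x in comap stoneCechUnit (𝓝 (h y')), φ b x = n := by
    have h1 : ∀ᶠ s in 𝓝 t, |s| + (if b then 1 / 2 else 0) ∈ Ioo (n : ℝ) (n + 2 / 3) := by
      have hcont : Continuous fun s : ℝ => |s| + (if b then 1 / 2 else 0) := by fun_prop
      exact hcont.continuousAt.eventually_mem (Ioo_mem_nhds hn.1 hn.2)
    have h2 : ∀ᶠ q in 𝓝 (e (h y')), q ∈ ((↑) : ℝ → OnePoint ℝ) ''
        {s | |s| + (if b then 1 / 2 else 0) ∈ Ioo (n : ℝ) (n + 2 / 3)} := by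
      rw [← ht]
      exact OnePoint.isOpenEmbedding_coe.isOpenMap.image_mem_nhds h1
    have h3 : Tendsto (fun x => e (stoneCechUnit x)) (comap stoneCechUnit (𝓝 (h y')))
        (𝓝 (e (h y'))) := (he.tendsto _).comp tendsto_comap
    filter_upwards [h3.eventually h2] with x hx
    rw [hef] at hx
    obtain ⟨s, hs, hsx⟩ := hx
    rw [OnePoint.coe_injective hsx] at hs
    exact stair_eq _ hs
  have hval := map_realMul_const T (hh y') (f := g) hloc
  have hlt := hy1 b
  beta_reduce at hlt
  rw [hval, hTg, ContinuousMap.const_apply, norm_smul, RCLike.norm_ofReal] at hlt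
  have h4 : M / ‖u‖ < |(n : ℝ)| := by
    refine lt_of_lt_of_le ?_ (le_abs_self _)
    have : (if b then (1 / 2 : ℝ) else 0) ≥ 0 := by split_ifs <;> norm_num
    linarith [hn.2]
  rw [div_lt_iff₀ hu0] at h4
  linarith

/-- The support maps of a biseparating map and of its inverse are mutually inverse. -/
theorem support_leftInverse [T35Space Y] [Nontrivial F]
    {T : C(X, E) →ₗ[𝕜] C(Y, F)} {S : C(Y, F) →ₗ[𝕜] C(X, E)}
    (hTS : ∀ g, T (S g) = g) {h : Y → X} {k : X → Y} (hk : Continuous k)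
    (hT : ∀ y, DependsOnGerm T (𝓝 (h y)) y) (hS : ∀ x, DependsOnGerm S (𝓝 (k x)) x) (y : Y) :
    k (h y) = y := by
  by_contra hne
  obtain ⟨W, V, hW, hV, hkW, hyV, hdis⟩ := t2_separation hne
  obtain ⟨u, hu⟩ := exists_ne (0 : F)
  obtain ⟨φ, h1, h0⟩ := exists_bump (hV.mem_nhds hyV)
  have hy : T (S (realMul 𝕜 φ (ContinuousMap.const Y u))) y = 0 := by
    refine hT y _ ?_
    filter_upwards [hk.continuousAt.eventually_mem (hW.mem_nhds hkW)] with x hx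
    refine hS x _ ?_
    filter_upwards [hW.mem_nhds hx] with z hz
    simp [(h0 z (disjoint_left.1 hdis hz)).self_of_nhds]
  rw [hTS] at hy
  simp [h1.self_of_nhds, hu] at hy

theorem exists_support_map [T35Space X] [T35Space Y] [Nontrivial F] (hX : IsRealcompact X)
    {T : C(X, E) →ₗ[𝕜] C(Y, F)} {S : C(Y, F) →ₗ[𝕜] C(X, E)} (hST : ∀ f, S (T f) = f)
    (hTS : ∀ g, T (S g) = g) (hT : IsSeparatingMap T) (hS : IsSeparatingMap S) :
    ∃ h : Y → X, Continuous h ∧ ∀ y, DependsOnGerm T (𝓝 (h y)) y := by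
  obtain ⟨u, hu⟩ := exists_ne (0 : F)
  have hne : ∀ y, ∃ f, T f y ≠ 0 := fun y => ⟨S (ContinuousMap.const Y u), by simp [hTS, hu]⟩
  choose f hf using hne
  choose h hh using fun y => exists_dependsOnGerm hT (hf y)
  have hc : Continuous h := continuous_of_dependsOnGerm (i := ⟨_, continuous_stoneCechUnit⟩) hh
    fun y => ⟨f y, hf y⟩
  choose k hk using mem_range_stoneCechUnit hX hST hTS hT hS hc hh
  have hi : IsInducing (stoneCechUnit : X → StoneCech X) := isInducing_stoneCechUnit
  refine ⟨k, ?_, fun y => ?_⟩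
  · rw [hi.continuous_iff]
    exact hc.congr fun y => (hk y).symm
  · rw [hi.nhds_eq_comap, hk]
    exact hh y

theorem exists_support_homeomorph [T35Space X] [T35Space Y] [Nontrivial E] [Nontrivial F]
    (hX : IsRealcompact X) (hY : IsRealcompact Y) {T : C(X, E) →ₗ[𝕜] C(Y, F)}
    (hT : IsBiseparatingMap T) :
    ∃ h : Y ≃ₜ X, ∀ y, DependsOnGerm T (𝓝 (h y)) y := by
  obtain ⟨hsep, S, hST, hTS, hS⟩ := hT
  obtain ⟨h, hc, hh⟩ := exists_support_map hX hST hTS hsep hS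
  obtain ⟨k, kc, hk⟩ := exists_support_map hY hTS hST hS hsep
  exact ⟨⟨⟨h, k, support_leftInverse hTS kc hh hk, support_leftInverse hST hc hk hh⟩, hc, kc⟩, hh⟩

/-- The factor grows at most like |log ‖f‖|, and r log r → 0, so the product is continuous at zeros
of `f`. -/
theorem exists_stair_log_smul (f : C(X, E)) (c : ℝ) :
    ∃ G : C(X, E), ∀ x, G x =
      ((stair (fun n : ℤ => (n : ℝ)) (-Real.log ‖f x‖ + c) : ℝ) : 𝕜) • f x := by
  refine ⟨⟨fun x => ((stair (fun n : ℤ => (n : ℝ)) (-Real.log ‖f x‖ + c) : ℝ) : 𝕜) • f x,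
    continuous_iff_continuousAt.2 fun x => ?_⟩, fun x => rfl⟩
  by_cases hx : f x = 0
  · rw [ContinuousAt, hx, smul_zero]
    refine squeeze_zero_norm (a := fun z => |‖f z‖ * Real.log ‖f z‖| + (|c| + 1) * ‖f z‖)
      (fun z => ?_) ?_
    · obtain ⟨m, hm, hle⟩ := exists_norm_stair_le (fun n : ℤ => (n : ℝ)) (-Real.log ‖f z‖ + c)
      rw [norm_smul, RCLike.norm_ofReal, abs_mul, abs_norm]
      have h1 : |(m : ℝ)| ≤ |Real.log ‖f z‖| + (|c| + 1) := by
        have h2 : (m : ℝ) = (m - (-Real.log ‖f z‖ + c)) + (-Real.log ‖f z‖ + c) := by ring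
        rw [h2]
        refine (abs_add_le _ _).trans ?_
        have h3 := abs_add_le (-Real.log ‖f z‖) c
        rw [abs_neg] at h3
        linarith
      rw [Real.norm_eq_abs, Real.norm_eq_abs] at hle
      calc _ ≤ (|Real.log ‖f z‖| + (|c| + 1)) * ‖f z‖ := by gcongr; exact hle.trans h1
        _ = _ := by ring
    · have hcont : Continuous fun z => |‖f z‖ * Real.log ‖f z‖| + (|c| + 1) * ‖f z‖ := by
        have := Real.continuous_mul_log.comp f.continuous.norm
        exact (continuous_abs.comp this).add (by fun_prop)
      simpa [hx] using hcont.tendsto x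
  · have h1 : ContinuousAt (fun z => Real.log ‖f z‖) x :=
      f.continuous.norm.continuousAt.log (norm_ne_zero_iff.2 hx)
    refine ContinuousAt.smul ?_ f.continuous.continuousAt
    exact RCLike.continuous_ofReal.continuousAt.comp
      ((continuous_stair _).continuousAt.comp (h1.neg.add continuousAt_const))

/-- If `T f y ≠ 0`, there are z near y with f (h z) nonzero but tiny. Near h z some `G b` is a large
integer multiple of `f`, so `T (G b)` would be unbounded near y. -/
theorem map_eq_zero_of_dependsOnGerm {T : C(X, E) →ₗ[𝕜] C(Y, F)} {h : Y ≃ₜ X}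
    (hh : ∀ y, DependsOnGerm T (𝓝 (h y)) y) {f : C(X, E)} {y : Y} (hf : f (h y) = 0) :
    T f y = 0 := by
  by_contra hne
  choose G hG using fun b : Bool => exists_stair_log_smul (𝕜 := 𝕜) f (if b then 1 / 2 else 0)
  obtain ⟨M, hM0, hM⟩ := eventually_norm_lt (fun b => T (G b)) y
  set δ := ‖T f y‖ / 2
  have hδ : 0 < δ := half_pos (norm_pos_iff.2 hne)
  have h1 : ∀ᶠ z in 𝓝 y, δ < ‖T f z‖ :=
    ((T f).continuous.norm.tendsto y).eventually_const_lt (half_lt_self (norm_pos_iff.2 hne))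
  have h2 : ∀ᶠ z in 𝓝 y, ‖f (h z)‖ < Real.exp (-(M / δ + 1)) :=
    ((f.continuous.comp h.continuous).norm.tendsto y).eventually_lt_const
      (by simp [hf, Real.exp_pos])
  have h3 : ∃ᶠ z in 𝓝 y, f (h z) ≠ 0 := fun hev => hne <| hh y f <| by
    rw [← h.map_nhds_eq, eventually_map]
    simpa using hev
  obtain ⟨z, hz0, ⟨hzM, hzδ⟩, hze⟩ := (h3.and_eventually ((hM.and h1).and h2)).exists
  have hlog : M / δ + 1 < -Real.log ‖f (h z)‖ := by
    have := Real.log_lt_log (norm_pos_iff.2 hz0) hze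
    rw [Real.log_exp] at this
    linarith
  obtain ⟨b, n, hn⟩ := exists_mem_step (-Real.log ‖f (h z)‖)
  have hloc : ∀ᶠ x in 𝓝 (h z), G b x = (((n : ℝ) : 𝕜) • f) x := by
    have h4 : ContinuousAt (fun x => -Real.log ‖f x‖ + if b then 1 / 2 else 0) (h z) :=
      (f.continuous.norm.continuousAt.log (norm_ne_zero_iff.2 hz0)).neg.add continuousAt_const
    filter_upwards [h4.eventually_mem (Ioo_mem_nhds hn.1 hn.2)] with x hx
    rw [hG, stair_eq _ hx, ContinuousMap.smul_apply]
  have hval := (hh z).congr hloc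
  have hlt := hzM b
  beta_reduce at hlt
  rw [hval, map_smul, ContinuousMap.smul_apply, norm_smul, RCLike.norm_ofReal] at hlt
  have h5 : M / δ < |(n : ℝ)| := by
    refine lt_of_lt_of_le ?_ (le_abs_self _)
    have : (if b then (1 / 2 : ℝ) else 0) ≥ 0 := by split_ifs <;> norm_num
    linarith [hn.2]
  rw [div_lt_iff₀ hδ] at h5
  have := mul_le_mul_of_nonneg_left hzδ.le (abs_nonneg (n : ℝ))
  linarith

/-- Biseparating maps between spaces of functions on realcompact spaces are weighted composition
maps. -/
theorem IsBiseparatingMap.exists_homeomorph [T35Space X] [T35Space Y] [Nontrivial E] [Nontrivial F]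
    (hX : IsRealcompact X) (hY : IsRealcompact Y) {T : C(X, E) →ₗ[𝕜] C(Y, F)}
    (hT : IsBiseparatingMap T) :
    ∃ h : Y ≃ₜ X, ∀ f y, T f y = T (ContinuousMap.const X (f (h y))) y := by
  obtain ⟨h, hh⟩ := exists_support_homeomorph hX hY hT
  refine ⟨h, fun f y => ?_⟩
  have := map_eq_zero_of_dependsOnGerm hh (f := f - ContinuousMap.const X (f (h y))) (y := y)
    (by simp)
  rwa [map_sub, ContinuousMap.sub_apply, sub_eq_zero] at this

end Representation

/-! ### Boundedness of the fiber maps -/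

section Continuity

variable {𝕜 X Y E F : Type*} [RCLike 𝕜] [TopologicalSpace X] [TopologicalSpace Y]
  [NormedAddCommGroup E] [NormedSpace 𝕜 E] [NormedAddCommGroup F] [NormedSpace 𝕜 F]

/-- The linear map between the fibers at `y` induced by `T`. -/
noncomputable def fiberMap (T : C(X, E) →ₗ[𝕜] C(Y, F)) (y : Y) : E →ₗ[𝕜] F where
  toFun e := T (ContinuousMap.const X e) y
  map_add' e e' := by
    rw [← ContinuousMap.add_apply, ← map_add]; rfl
  map_smul' c e := by
    rw [RingHom.id_apply, ← ContinuousMap.smul_apply, ← map_smul]; rfl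

theorem fiberMap_apply (T : C(X, E) →ₗ[𝕜] C(Y, F)) (y : Y) (e : E) :
    fiberMap T y e = T (ContinuousMap.const X e) y := rfl

theorem continuous_fiberMap_apply (T : C(X, E) →ₗ[𝕜] C(Y, F)) (e : E) :
    Continuous fun y => fiberMap T y e := (T (ContinuousMap.const X e)).continuous

/-- The square is shared out: scaling the image to norm n + 1 leaves a vector of norm at most 1 / (n
+ 1). -/
theorem exists_rescale (L : E →ₗ[𝕜] F) {n : ℕ} {e : E} (h : ((n : ℝ) + 1) ^ 2 * ‖e‖ < ‖L e‖) :
    ∃ e' : E, ‖e'‖ ≤ 1 / ((n : ℝ) + 1) ∧ (n : ℝ) < ‖L e'‖ := by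
  have hn : (0 : ℝ) < n + 1 := by positivity
  have hL : 0 < ‖L e‖ := lt_of_le_of_lt (by positivity) h
  have hs : 0 ≤ ((n : ℝ) + 1) / ‖L e‖ := by positivity
  refine ⟨((((n : ℝ) + 1) / ‖L e‖ : ℝ) : 𝕜) • e, ?_, ?_⟩
  · rw [norm_smul, RCLike.norm_ofReal, abs_of_nonneg hs, le_div_iff₀ hn, div_mul_eq_mul_div,
      div_mul_eq_mul_div, div_le_one hL]
    linarith
  · rw [map_smul, norm_smul, RCLike.norm_ofReal, abs_of_nonneg hs, div_mul_cancel₀ _ hL.ne']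
    linarith

theorem lt_two_zpow {r c : ℝ} {n : ℕ} (hr : 0 < r) (hc : c ≤ 1 / 2)
    (h : (n : ℝ) + 1 < -Real.logb 2 r + c) : r < (2 : ℝ)⁻¹ ^ n := by
  have h1 : Real.logb 2 r < -n := by linarith
  rwa [Real.logb_lt_iff_lt_rpow (by norm_num) hr, Real.rpow_neg (by norm_num),
    Real.rpow_natCast, ← inv_pow] at h1

theorem ite_half_le (b : Bool) : (if b then (1 / 2 : ℝ) else 0) ≤ 1 / 2 := by
  split_ifs <;> norm_num

theorem ite_half_nonneg (b : Bool) : 0 ≤ (if b then (1 / 2 : ℝ) else 0) := by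
  split_ifs <;> norm_num

/-- At points which are not P-points, the fiber maps of a weighted composition map are bounded. -/
theorem fiberMap_bound [CompletelyRegularSpace Y] {T : C(X, E) →ₗ[𝕜] C(Y, F)} {h : Y ≃ₜ X}
    (hrep : ∀ f y, T f y = fiberMap T y (f (h y))) {y : Y} (hy : ¬ IsPPoint y) :
    ∃ M : ℝ, ∀ e, ‖fiberMap T y e‖ ≤ M * ‖e‖ := by
  let _ : NormedSpace ℝ E := NormedSpace.restrictScalars ℝ 𝕜 E
  by_contra! hcon
  choose e₀ he₀ using fun n : ℕ => hcon (((n : ℝ) + 1) ^ 2)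
  choose e he heL using fun n : ℕ => exists_rescale _ (he₀ n)
  unfold IsPPoint at hy
  push Not at hy
  obtain ⟨W, hW, hW'⟩ := hy
  -- Including `W n` prevents `f` from vanishing on a neighbourhood of `y`.
  obtain ⟨f, hfy, hf0, hfU⟩ := exists_depth (x := y)
    (U := fun n => {z | (n : ℝ) < ‖fiberMap T z (e n)‖} ∩ W n) fun n => inter_mem
      (((continuous_fiberMap_apply T (e n)).norm.tendsto y).eventually_const_lt (heL n)) (hW n)
  -- The shift by 1 is needed because step n, with offset up to 1/2, only ensures f < 2⁻¹ ^ (n - 1).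
  have hv : Tendsto (fun m : ℤ => e (m - 1).toNat) atTop (𝓝 0) := by
    have h1 : Tendsto e atTop (𝓝 0) :=
      squeeze_zero_norm he tendsto_one_div_add_atTop_nhds_zero_nat
    refine h1.comp (tendsto_atTop.2 fun n => ?_)
    filter_upwards [eventually_ge_atTop ((n : ℤ) + 1)] with m hm
    omega
  choose G hG using fun b : Bool => exists_stair_comp
    (f.comp ⟨h.symm, h.symm.continuous⟩) (fun x => hf0 _) _ hv (if b then 1 / 2 else 0)
  obtain ⟨M, hM0, hM⟩ := eventually_norm_lt (fun b => T (G b)) y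
  have h2 : ∀ᶠ z in 𝓝 y, f z < (2 : ℝ) ^ (-(M + 2)) :=
    (f.continuous.tendsto y).eventually_lt_const (by rw [hfy]; positivity)
  have h3 : ∃ᶠ z in 𝓝 y, f z ≠ 0 := fun hev => hW' <| by
    filter_upwards [hev] with z hz
    refine mem_iInter.2 fun n => (hfU n z ?_).2
    rw [not_not.1 hz]
    positivity
  obtain ⟨z, hz0, hzM, hzf⟩ := (h3.and_eventually (hM.and h2)).exists
  have hpos : 0 < f z := lt_of_le_of_ne (hf0 z) (Ne.symm hz0)
  rw [← Real.logb_lt_iff_lt_rpow (by norm_num) hpos] at hzf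
  obtain ⟨b, n, hn⟩ := exists_mem_step (-Real.logb 2 (f z))
  have hlt := hzM b
  rw [hrep, hG b (h z) n (by simpa using hpos) (by simpa using hn)] at hlt
  have hn1 : M + 1 < n := by linarith [hn.2, ite_half_nonneg b]
  have hn2 : (1 : ℤ) ≤ n := by
    have : (1 : ℝ) ≤ n := by linarith
    exact_mod_cast this
  obtain ⟨k, hk⟩ := Int.eq_ofNat_of_zero_le (sub_nonneg.2 hn2)
  have hnk : (n : ℝ) = k + 1 := by
    have : n = k + 1 := by omega
    rw [this]; push_cast; ring
  have h4 := (hfU k z (lt_two_zpow hpos (ite_half_le b) (by rw [← hnk]; exact hn.1))).1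
  have h5 : (n - 1).toNat = k := by omega
  rw [h5] at hlt
  have h6 : (k : ℝ) < ‖fiberMap T z (e k)‖ := h4
  linarith

/-- A sequence along which the fiber maps blow up takes each cluster value infinitely often. -/
theorem frequently_eq_of_mapClusterPt [T35Space Y] {T : C(X, E) →ₗ[𝕜] C(Y, F)}
    {h : Y ≃ₜ X} (hrep : ∀ f y, T f y = fiberMap T y (f (h y))) {K : Set Y} (hK : IsCompact K)
    {y : ℕ → Y} (hyK : ∀ n, y n ∈ K) {e : ℕ → E} (he : ∀ n, ‖e n‖ ≤ 1 / ((n : ℝ) + 1))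
    (heL : ∀ n : ℕ, (n : ℝ) < ‖fiberMap T (y n) (e n)‖) {a : Y} (ha : MapClusterPt a atTop y) :
    ∃ᶠ n in atTop, y n = a := by
  classical
  let _ : NormedSpace ℝ E := NormedSpace.restrictScalars ℝ 𝕜 E
  by_contra hcon
  obtain ⟨N, hN⟩ := (not_frequently.1 hcon).exists_forall_of_atTop
  obtain ⟨f, hfa, hf0, hfU⟩ := exists_depth (x := a)
    (U := fun n => if N ≤ n then {y n}ᶜ else univ) fun n => by
      split_ifs with hn
      · exact isOpen_compl_singleton.mem_nhds fun h => hN n hn h.symm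
      · exact univ_mem
  have hfy : ∀ n, N ≤ n → (2 : ℝ)⁻¹ ^ n ≤ f (y n) := fun n hn => by
    by_contra! hlt
    have := hfU n (y n) hlt
    rw [if_pos hn] at this
    exact this rfl
  have hpos : ∀ n, N ≤ n → 0 < f (y n) := fun n hn => lt_of_lt_of_le (by positivity) (hfy n hn)
  let P : Bool → ℤ → ℕ → Prop := fun b m n => N ≤ n ∧
    -Real.logb 2 (f (y n)) + (if b then 1 / 2 else 0) ∈ Ioo (m : ℝ) (m + 2 / 3)
  have hmn : ∀ b m n, P b m n → m ≤ n := fun b m n hP => by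
    by_contra! hlt
    have h1 : (n : ℝ) + 1 ≤ m := by exact_mod_cast hlt
    have := lt_two_zpow (hpos n hP.1) (ite_half_le b) (lt_of_le_of_lt h1 hP.2.1)
    exact absurd this (not_lt.2 (hfy n hP.1))
  -- Many `y n` may share a step, so one is chosen. Since f (y n) ≥ 2⁻¹ ^ n gives m ≤ n, `v` tends
  -- to 0. The chosen point need not be near `a`, hence the bound on all of `K`.
  let v : Bool → ℤ → E := fun b m => if H : ∃ n, P b m n then e H.choose else 0
  have hv : ∀ b, Tendsto (v b) atTop (𝓝 0) := fun b => by
    have h1 : Tendsto (fun m : ℤ => 1 / ((m.toNat : ℝ) + 1)) atTop (𝓝 0) := by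
      refine (tendsto_one_div_add_atTop_nhds_zero_nat (𝕜 := ℝ)).comp (tendsto_atTop.2 fun n => ?_)
      filter_upwards [eventually_ge_atTop (n : ℤ)] with m hm
      omega
    refine squeeze_zero_norm (fun m => ?_) h1
    by_cases H : ∃ n, P b m n
    · simp only [v, dif_pos H]
      refine (he _).trans ?_
      have h2 := hmn b m _ H.choose_spec
      have h3 : (m.toNat : ℝ) ≤ H.choose := by
        have : m.toNat ≤ H.choose := by omega
        exact_mod_cast this
      gcongr
    · simp only [v, dif_neg H, norm_zero]
      positivity
  choose G hG using fun b : Bool => exists_stair_comp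
    (f.comp ⟨h.symm, h.symm.continuous⟩) (fun x => hf0 _) _ (hv b) (if b then 1 / 2 else 0)
  choose C hC using fun b : Bool => hK.exists_bound_of_continuousOn (T (G b)).continuous.continuousOn
  have h2 : ∀ᶠ z in 𝓝 a, f z < (2 : ℝ) ^ (-(|C true| + |C false| + 1)) :=
    (f.continuous.tendsto a).eventually_lt_const (by rw [hfa]; positivity)
  obtain ⟨n, hnf, hnN⟩ := ((mapClusterPt_iff_frequently.1 ha _ h2).and_eventually
    (eventually_ge_atTop N)).exists
  have hnf : f (y n) < (2 : ℝ) ^ (-(|C true| + |C false| + 1)) := hnf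
  rw [← Real.logb_lt_iff_lt_rpow (by norm_num) (hpos n hnN)] at hnf
  obtain ⟨b, m, hm⟩ := exists_mem_step (-Real.logb 2 (f (y n)))
  have H : ∃ n, P b m n := ⟨n, hnN, hm⟩
  obtain ⟨h3, h4⟩ := H.choose_spec
  have h5 := hmn b m _ H.choose_spec
  have hle := hC b (y H.choose) (hyK _)
  rw [hrep, hG b _ m (by simpa using hpos _ h3) (by simpa using h4)] at hle
  simp only [v, dif_pos H] at hle
  have h6 := heL H.choose
  have h7 : (m : ℝ) ≤ H.choose := by exact_mod_cast h5
  have h8 : C b ≤ |C true| + |C false| := by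
    have h9 := le_abs_self (C b)
    have h10 := abs_nonneg (C true)
    have h11 := abs_nonneg (C false)
    cases b <;> linarith
  linarith [hm.2, ite_half_nonneg b]

/-- A blow-up sequence meets its cluster point `a` infinitely often, so `a` is a P-point. The
corresponding countably many open conditions then hold together near `a`, making all nearby points
P-points. -/
theorem exists_fiberMap_bound_of_isCompact [T35Space Y] {T : C(X, E) →ₗ[𝕜] C(Y, F)}
    {h : Y ≃ₜ X} (hrep : ∀ f y, T f y = fiberMap T y (f (h y)))
    (hP : interior {y : Y | IsPPoint y} = ∅) {K : Set Y} (hK : IsCompact K) :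
    ∃ M : ℝ, ∀ y ∈ K, ∀ e, ‖fiberMap T y e‖ ≤ M * ‖e‖ := by
  classical
  by_contra! hcon
  choose y hyK e₀ he₀ using fun n : ℕ => hcon (((n : ℝ) + 1) ^ 2)
  choose e he heL using fun n : ℕ => exists_rescale _ (he₀ n)
  obtain ⟨a, -, ha⟩ := hK.exists_mapClusterPt_of_frequently (l := atTop) (f := y)
    (Frequently.of_forall hyK)
  have hfreq := frequently_eq_of_mapClusterPt hrep hK hyK he heL ha
  have hbdd : ∀ z, (∃ᶠ n : ℕ in atTop, (n : ℝ) < ‖fiberMap T z (e n)‖) → IsPPoint z := fun z hz => by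
    by_contra hzP
    obtain ⟨M, hM⟩ := fiberMap_bound hrep hzP
    obtain ⟨N, hN⟩ := exists_nat_gt |M|
    obtain ⟨n, hn, hnN⟩ := (hz.and_eventually (eventually_ge_atTop N)).exists
    have h1 : (N : ℝ) ≤ n := by exact_mod_cast hnN
    have h2 : ‖e n‖ ≤ 1 := (he n).trans (by
      rw [div_le_one (by positivity)]; linarith [n.cast_nonneg (α := ℝ)])
    have h3 : M * ‖e n‖ ≤ |M| * 1 :=
      mul_le_mul (le_abs_self M) h2 (norm_nonneg _) (abs_nonneg M)
    linarith [hM (e n)]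
  have haP : IsPPoint a := hbdd a (hfreq.mono fun n hn => hn ▸ heL n)
  have hnhds := haP (fun n => if y n = a then {z | (n : ℝ) < ‖fiberMap T z (e n)‖} else univ)
    fun n => by
      split_ifs with hn
      · exact ((continuous_fiberMap_apply T (e n)).norm.tendsto a).eventually_const_lt (hn ▸ heL n)
      · exact univ_mem
  have hint : a ∈ interior {y : Y | IsPPoint y} := by
    rw [mem_interior_iff_mem_nhds]
    filter_upwards [hnhds] with z hz
    refine hbdd z (hfreq.mono fun n hn => ?_)
    have := mem_iInter.1 hz n
    rwa [if_pos hn] at this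
  rw [hP] at hint
  exact hint

theorem continuous_of_fiberMap_bound {T : C(X, E) →ₗ[𝕜] C(Y, F)}
    {h : Y → X} (hc : Continuous h) (hrep : ∀ f y, T f y = fiberMap T y (f (h y)))
    (hM : ∀ K : Set Y, IsCompact K → ∃ M : ℝ, ∀ y ∈ K, ∀ e, ‖fiberMap T y e‖ ≤ M * ‖e‖) :
    Continuous T := by
  rw [continuous_iff_continuousAt]
  intro f₀
  rw [ContinuousAt, ContinuousMap.tendsto_iff_forall_isCompact_tendstoUniformlyOn]
  intro K hK
  obtain ⟨M, hM⟩ := hM K hK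
  rw [Metric.tendstoUniformlyOn_iff]
  intro ε hε
  have h1 := (ContinuousMap.tendsto_iff_forall_isCompact_tendstoUniformlyOn.1
    (tendsto_id (x := 𝓝 f₀))) (h '' K) (hK.image hc)
  have hδ : 0 < ε / (|M| + 1) := by positivity
  filter_upwards [Metric.tendstoUniformlyOn_iff.1 h1 _ hδ] with f hf y hy
  have h2 := hf (h y) (mem_image_of_mem h hy)
  rw [dist_eq_norm, id_eq] at h2
  rw [dist_eq_norm, hrep f₀, hrep f, ← map_sub]
  refine (hM y hy _).trans_lt ?_
  rw [lt_div_iff₀ (by positivity)] at h2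
  have h3 := mul_le_mul_of_nonneg_right (le_abs_self M) (norm_nonneg (f₀ (h y) - f (h y)))
  nlinarith [norm_nonneg (f₀ (h y) - f (h y))]

end Continuity

/-! ### P-points and discontinuous examples -/

section PPoint

variable {𝕜 Y E F : Type*} [RCLike 𝕜] [TopologicalSpace Y]
  [NormedAddCommGroup E] [NormedSpace 𝕜 E] [NormedAddCommGroup F] [NormedSpace 𝕜 F]

theorem IsPPoint.eventually_eq {y : Y} (hy : IsPPoint y) (f : C(Y, E)) :
    ∀ᶠ z in 𝓝 y, f z = f y := by
  have h := hy (fun n => {z | dist (f z) (f y) < 1 / ((n : ℝ) + 1)}) fun n =>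
    f.continuous.continuousAt.eventually_mem (Metric.ball_mem_nhds _ (by positivity))
  filter_upwards [h] with z hz
  rw [← dist_le_zero]
  refine le_of_forall_pos_lt_add fun ε hε => ?_
  obtain ⟨n, hn⟩ := exists_nat_one_div_lt hε
  have h1 : dist (f z) (f y) < 1 / ((n : ℝ) + 1) := mem_iInter.1 hz n
  linarith

/-- A P-point interior to the set of P-points has a clopen neighbourhood consisting of P-points. -/
theorem exists_isClopen_isPPoint [CompletelyRegularSpace Y] {y : Y}
    (hy : y ∈ interior {y : Y | IsPPoint y}) :
    ∃ V : Set Y, IsClopen V ∧ y ∈ V ∧ ∀ z ∈ V, IsPPoint z := by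
  obtain ⟨φ, h0, -, h1⟩ := exists_continuousMap_zero_one (mem_interior_iff_mem_nhds.1 hy)
  have hV : ∀ z ∈ {z | φ z = 0}, IsPPoint z := fun z hz => by
    by_contra hzP
    have h2 := h1 z hzP
    rw [hz] at h2
    exact zero_ne_one h2
  refine ⟨{z | φ z = 0}, ⟨isClosed_eq φ.continuous continuous_const, ?_⟩, h0, hV⟩
  rw [isOpen_iff_mem_nhds]
  intro z hz
  filter_upwards [(hV z hz).eventually_eq φ] with w hw
  exact hw.trans hz

/-- A family of linear bijections between the fibers induces a biseparating map as soon as it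
preserves continuity. -/
theorem exists_isBiseparatingMap (J : Y → E ≃ₗ[𝕜] F)
    (hJ : ∀ f : C(Y, E), Continuous fun y => J y (f y))
    (hJ' : ∀ g : C(Y, F), Continuous fun y => (J y).symm (g y)) :
    ∃ T : C(Y, E) →ₗ[𝕜] C(Y, F), (∀ f y, T f y = J y (f y)) ∧ IsBiseparatingMap T := by
  refine ⟨⟨⟨fun f => ⟨_, hJ f⟩, fun f g => ?_⟩, fun c f => ?_⟩, fun f y => rfl, ?_,
    ⟨⟨fun g => ⟨_, hJ' g⟩, fun f g => ?_⟩, fun c f => ?_⟩, fun f => ?_, fun g => ?_, ?_⟩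
  · ext y; simp
  · ext y; simp
  · intro f g h y
    simpa using h y
  · ext y; simp
  · ext y; simp
  · ext y; simp
  · ext y; simp
  · intro f g h y
    simpa using h y

theorem IsPPoint.continuousAt_comp {y : Y} (hy : IsPPoint y) (f : C(Y, E)) (J : E → F) :
    ContinuousAt (fun z => J (f z)) y :=
  (continuousAt_const (y := J (f y))).congr <|
    (hy.eventually_eq f).mono fun z hz => by simp [hz]

/-- Linearly isomorphic infinite-dimensional normed spaces admit an unbounded isomorphism. -/
theorem exists_unbounded_linearEquiv (hE : ¬ FiniteDimensional 𝕜 E) (J₀ : E ≃ₗ[𝕜] F) :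
    ∃ J : E ≃ₗ[𝕜] F, ∀ M : ℝ, ∃ e, M * ‖e‖ < ‖J e‖ := by
  let b := Module.Basis.ofVectorSpace 𝕜 E
  have hinf : Infinite (Module.Basis.ofVectorSpaceIndex 𝕜 E) := by
    by_contra hfin
    rw [not_infinite_iff_finite] at hfin
    exact hE (Module.Finite.of_basis b)
  let c := b.map J₀
  let emb := Infinite.natEmbedding (Module.Basis.ofVectorSpaceIndex 𝕜 E)
  -- The weights give `b (emb n)` an image of norm (n + 1)‖b (emb n)‖; off the range of `emb` the
  -- default index is harmless, positivity being enough.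
  let a : Module.Basis.ofVectorSpaceIndex 𝕜 E → ℝ := fun i =>
    (((Function.invFun emb i : ℕ) : ℝ) + 1) * ‖b i‖ / ‖c i‖
  have hb : ∀ i, 0 < ‖b i‖ := fun i => norm_pos_iff.2 (b.ne_zero i)
  have hc : ∀ i, 0 < ‖c i‖ := fun i => norm_pos_iff.2 (c.ne_zero i)
  have ha : ∀ i, 0 < a i := fun i => div_pos (mul_pos (by positivity) (hb i)) (hc i)
  let w : Module.Basis.ofVectorSpaceIndex 𝕜 E → 𝕜ˣ := fun i =>
    Units.mk0 (a i : 𝕜) (by exact_mod_cast (ha i).ne')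
  refine ⟨b.equiv (c.unitsSMul w) (Equiv.refl _), fun M => ?_⟩
  obtain ⟨n, hn⟩ := exists_nat_gt M
  refine ⟨b (emb n), ?_⟩
  have h1 : ‖b.equiv (c.unitsSMul w) (Equiv.refl _) (b (emb n))‖ = ((n : ℝ) + 1) * ‖b (emb n)‖ := by
    rw [Module.Basis.equiv_apply, Equiv.refl_apply, Module.Basis.unitsSMul_apply, Units.smul_def,
      norm_smul]
    simp only [w, Units.val_mk0, RCLike.norm_ofReal, abs_of_pos (ha _), a]
    rw [Function.leftInverse_invFun emb.injective, div_mul_cancel₀ _ (hc _).ne']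
  rw [h1]
  exact mul_lt_mul_of_pos_right (by linarith) (hb _)

/-- An open set of P-points carries a discontinuous biseparating map. -/
theorem exists_isBiseparatingMap_not_continuous [CompletelyRegularSpace Y]
    (hF : ¬ FiniteDimensional 𝕜 F) (hP : (interior {y : Y | IsPPoint y}).Nonempty) :
    ∃ T : C(Y, F) →ₗ[𝕜] C(Y, F), IsBiseparatingMap T ∧ ¬ Continuous T := by
  classical
  obtain ⟨y, hy⟩ := hP
  obtain ⟨V, hV, hyV, hVP⟩ := exists_isClopen_isPPoint hy
  obtain ⟨J, hJ⟩ := exists_unbounded_linearEquiv hF (LinearEquiv.refl 𝕜 F)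
  have hcont : ∀ (I : F → F) (f : C(Y, F)), Continuous fun z => if z ∈ V then I (f z) else f z := by
    intro I f
    rw [continuous_iff_continuousAt]
    intro z
    by_cases hz : z ∈ V
    · refine ((hVP z hz).continuousAt_comp f I).congr ?_
      filter_upwards [hV.isOpen.mem_nhds hz] with w hw
      simp [hw]
    · refine f.continuous.continuousAt.congr ?_
      filter_upwards [hV.compl.isOpen.mem_nhds hz] with w hw
      rw [if_neg hw]
  obtain ⟨T, hT, hTb⟩ := exists_isBiseparatingMap
    (fun z => if z ∈ V then J else LinearEquiv.refl 𝕜 F)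
    (fun f => (hcont J f).congr fun z => by split_ifs <;> rfl)
    (fun f => (hcont J.symm f).congr fun z => by split_ifs <;> rfl)
  refine ⟨T, hTb, fun hTc => ?_⟩
  have hJc : Continuous J := by
    have h1 : Continuous fun e : F => T (ContinuousMap.const Y e) y :=
      (continuous_eval_const y).comp (hTc.comp ContinuousMap.continuous_const')
    refine h1.congr fun e => ?_
    rw [hT, if_pos hyV, ContinuousMap.const_apply]
  let L : F →L[𝕜] F := ⟨J.toLinearMap, hJc⟩
  obtain ⟨e, he⟩ := hJ ‖L‖
  exact absurd he (not_lt.2 (L.le_opNorm e))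

theorem forall_isPPoint_iff [T35Space Y] (hE : ¬ FiniteDimensional 𝕜 E) (J₀ : E ≃ₗ[𝕜] F) :
    (∀ y : Y, IsPPoint y) ↔ ∀ J : E ≃ₗ[𝕜] F, ∃ T : C(Y, E) →ₗ[𝕜] C(Y, F),
      (∀ (f : C(Y, E)) (y : Y), T f y = J (f y)) ∧ IsBiseparatingMap T := by
  constructor
  · intro hP J
    exact exists_isBiseparatingMap (fun _ => J)
      (fun f => continuous_iff_continuousAt.2 fun y => (hP y).continuousAt_comp f J)
      (fun g => continuous_iff_continuousAt.2 fun y => (hP y).continuousAt_comp g J.symm)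
  · intro h y
    by_contra hy
    obtain ⟨J, hJ⟩ := exists_unbounded_linearEquiv hE J₀
    obtain ⟨T, hT, -⟩ := h J
    have hfib : ∀ z e, fiberMap T z e = J e := fun z e => by
      rw [fiberMap_apply, hT, ContinuousMap.const_apply]
    obtain ⟨M, hM⟩ := fiberMap_bound (T := T) (h := Homeomorph.refl Y)
      (fun f z => by rw [hfib, hT]; rfl) hy
    obtain ⟨e, he⟩ := hJ M
    have := hM e
    rw [hfib] at this
    exact absurd he (not_lt.2 this)

end PPoint

theorem theorem3p2 {𝕜 X Y : Type*} {E : Type u} {F : Type v} [RCLike 𝕜]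
    [TopologicalSpace X] [T35Space X] (hX : IsRealcompact X)
    [TopologicalSpace Y] [T35Space Y] (hY : IsRealcompact Y)
    [NormedAddCommGroup E] [NormedSpace 𝕜 E] (hE : ¬ FiniteDimensional 𝕜 E)
    [NormedAddCommGroup F] [NormedSpace 𝕜 F] (hF : ¬ FiniteDimensional 𝕜 F) :
    (interior {y : Y | IsPPoint y} = ∅ →
      ∀ T : C(X, E) →ₗ[𝕜] C(Y, F), IsBiseparatingMap T → Continuous T) ∧
    ((interior {y : Y | IsPPoint y}).Nonempty →
      ∃ T : C(Y, F) →ₗ[𝕜] C(Y, F), IsBiseparatingMap T ∧ ¬ Continuous T) ∧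
    (Cardinal.lift.{v} (Module.rank 𝕜 E) = Cardinal.lift.{u} (Module.rank 𝕜 F) →
      ((∀ y : Y, IsPPoint y) ↔
        ∀ J : E ≃ₗ[𝕜] F, ∃ T : C(Y, E) →ₗ[𝕜] C(Y, F),
          (∀ (f : C(Y, E)) (y : Y), T f y = J (f y)) ∧ IsBiseparatingMap T)) := by
  refine ⟨fun hP T hT => ?_, exists_isBiseparatingMap_not_continuous hF, fun hrank => ?_⟩
  · have : Nontrivial E := by
      by_contra h
      rw [not_nontrivial_iff_subsingleton] at h
      exact hE inferInstance
    have : Nontrivial F := by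
      by_contra h
      rw [not_nontrivial_iff_subsingleton] at h
      exact hF inferInstance
    obtain ⟨h, hrep⟩ := hT.exists_homeomorph hX hY
    exact continuous_of_fiberMap_bound h.continuous hrep fun K hK =>
      exists_fiberMap_bound_of_isCompact hrep hP hK
  · obtain ⟨J₀⟩ := nonempty_linearEquiv_of_lift_rank_eq hrank
    exact forall_isPPoint_iff hE J₀
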